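/- Let $p$ be a prime and let $k$ be a field of characteristic $p$ of finite degree of imperfection $r > 0$; that is, $k$ has a $p$-basis $\lambda_1, \dots, \lambda_r$, meaning that the monomials $\prod_{i=1}^r \lambda_i^{f(i)}$ with $0 \le f(i) < p$ form a basis of $k$ over $k^p$. A $p$-polynomial over $k$ is a polynomial of the form $\sum_{i=1}^n \sum_{j} c_{i,j} X_i^{p^j} \in k[X_1, \dots, X_n]$ (a finite sum with $c_{i,j} \in k$). Let $P, L \in k[X_1, \dots, X_{p^r}]$ be $p$-polynomials such that $P$ is homogeneous of degree $p$ and universal, i.e. the map $k^{p^r} \to k$, $x \mapsto P(x)$, is surjective, and such that $L$ is homogeneous of degree $1$ and nonzero. Let $\mathscr{V}_{P,L} := \{P + L = 0\} \subset \mathbf{G}_{\mathrm{a}}^{p^r}$, a commutative $k$-group scheme under addition of coordinates. Then the ring $\operatorname{End}(\mathscr{V}_{P,L})$ of endomorphisms of the $k$-group scheme $\mathscr{V}_{P,L}$ (with pointwise addition, and composition as multiplication) is isomorphic to $\mathbf{F}_p$; that is, every endomorphism is multiplication by a unique element of $\mathbf{F}_p$. -/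

import Mathlib

open CategoryTheory AlgebraicGeometry MvPolynomial Opposite

universe u

noncomputable section

/-! ### The degree of imperfection -/

/-- `b = (b₁, …, bᵣ)` is a `p`-basis of the field `k` of characteristic `p`: the monomials
`∏ bᵢ ^ f(i)` with `0 ≤ f(i) < p` form a basis of `k` as a vector space over `kᵖ`. -/
def IsPBasis {k : Type u} [Field k] (p : ℕ) [Fact p.Prime] [CharP k p] {r : ℕ}
    (b : Fin r → k) : Prop :=
  LinearIndependent (frobenius k p).fieldRange
      (fun f : Fin r → Fin p => ∏ i, b i ^ (f i : ℕ)) ∧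
    Submodule.span (frobenius k p).fieldRange
      (Set.range fun f : Fin r → Fin p => ∏ i, b i ^ (f i : ℕ)) = ⊤

/-- `k` has (finite) degree of imperfection `r`: it has a `p`-basis with `r` elements. -/
def HasDegreeOfImperfection (k : Type u) [Field k] (p : ℕ) [Fact p.Prime] [CharP k p]
    (r : ℕ) : Prop :=
  ∃ b : Fin r → k, IsPBasis p b

/-! ### `p`-polynomials -/

/-- `F ∈ k[X₁, …, Xₙ]` is a `p`-polynomial: `F = ∑ i, ∑ j, c i j * Xᵢ ^ (p ^ j)`. -/
def IsPPolynomial {k : Type u} [Field k] (p : ℕ) {n : ℕ} (F : MvPolynomial (Fin n) k) : Prop :=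
  ∃ (N : ℕ) (c : Fin n → ℕ → k), F = ∑ i, ∑ j ∈ Finset.range N, C (c i j) * X i ^ (p ^ j)

/-- `P` is universal over `k`: the map `kⁿ → k` that it defines is surjective. -/
def IsUniversal {k : Type u} [Field k] {n : ℕ} (P : MvPolynomial (Fin n) k) : Prop :=
  Function.Surjective fun x : Fin n → k => eval x P

theorem IsPPolynomial.add {k : Type u} [Field k] {p n : ℕ} {F G : MvPolynomial (Fin n) k}
    (hF : IsPPolynomial p F) (hG : IsPPolynomial p G) : IsPPolynomial p (F + G) := by
  have key : ∀ (N M : ℕ) (c : Fin n → ℕ → k), N ≤ M →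
      ∑ i, ∑ j ∈ Finset.range N, C (c i j) * X i ^ (p ^ j) =
      ∑ i, ∑ j ∈ Finset.range M,
        (C (if j < N then c i j else 0) * X i ^ (p ^ j) : MvPolynomial (Fin n) k) := by
    intro N M c h
    refine Finset.sum_congr rfl fun i _ => ?_
    rw [← Finset.sum_subset (Finset.range_mono h)]
    · refine Finset.sum_congr rfl fun j hj => ?_
      rw [if_pos (Finset.mem_range.1 hj)]
    · intro j _ hj
      rw [if_neg (by simpa using hj)]
      simp
  obtain ⟨N, c, rfl⟩ := hF
  obtain ⟨M, d, rfl⟩ := hG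
  refine ⟨max N M, fun i j => (if j < N then c i j else 0) + (if j < M then d i j else 0), ?_⟩
  rw [key N (max N M) c (le_max_left _ _), key M (max N M) d (le_max_right _ _),
    ← Finset.sum_add_distrib]
  refine Finset.sum_congr rfl fun i _ => ?_
  rw [← Finset.sum_add_distrib]
  refine Finset.sum_congr rfl fun j _ => ?_
  rw [C_add, add_mul]

section Aeval

variable {k : Type u} [Field k] {p : ℕ} [Fact p.Prime] [CharP k p] {n : ℕ}
  {F : MvPolynomial (Fin n) k}

theorem IsPPolynomial.aeval_add (hF : IsPPolynomial p F) {R : Type u} [CommRing R] [Algebra k R]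
    (x y : Fin n → R) : aeval (x + y) F = aeval x F + aeval y F := by
  obtain ⟨N, c, rfl⟩ := hF
  rcases subsingleton_or_nontrivial R with h | h
  · exact Subsingleton.elim _ _
  have : CharP R p := charP_of_injective_algebraMap (algebraMap k R).injective p
  simp only [map_sum, map_mul, map_pow, aeval_X, algHom_C, Pi.add_apply, add_pow_char_pow,
    mul_add, Finset.sum_add_distrib]

theorem IsPPolynomial.aeval_zero (hF : IsPPolynomial p F) {R : Type u} [CommRing R]
    [Algebra k R] : aeval (0 : Fin n → R) F = 0 := by
  have := hF.aeval_add (0 : Fin n → R) 0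
  rw [add_zero] at this
  simpa using this

theorem IsPPolynomial.aeval_neg (hF : IsPPolynomial p F) {R : Type u} [CommRing R]
    [Algebra k R] (x : Fin n → R) : aeval (-x) F = -aeval x F := by
  have := hF.aeval_add x (-x)
  rw [add_neg_cancel, hF.aeval_zero] at this
  exact (neg_eq_of_add_eq_zero_right this.symm).symm

end Aeval

/-! ### The group scheme `{F = 0} ⊆ 𝔾ₐⁿ` -/

section VanishingGroup

variable {k : Type u} [Field k] (p : ℕ) [Fact p.Prime] [CharP k p] {n : ℕ}
  (F : MvPolynomial (Fin n) k) (hF : IsPPolynomial p F)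

/-- The subgroup `{x ∈ Rⁿ | F(x) = 0}` of `𝔾ₐⁿ(R) = Rⁿ`, for a `k`-algebra `R`. -/
def zeroSubgroup (R : Type u) [CommRing R] [Algebra k R] : AddSubgroup (Fin n → R) where
  carrier := {x | aeval x F = 0}
  zero_mem' := hF.aeval_zero
  add_mem' {x y} hx hy := by
    change aeval (x + y) F = 0
    rw [hF.aeval_add, show aeval x F = 0 from hx, show aeval y F = 0 from hy, add_zero]
  neg_mem' {x} hx := by
    change aeval (-x) F = 0
    rw [hF.aeval_neg, show aeval x F = 0 from hx, neg_zero]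

/-- The functor of points `R ↦ {x ∈ Rⁿ | F(x) = 0}` of `{F = 0} ⊆ 𝔾ₐⁿ` on `k`-algebras. Mathlib
writes the laws of group objects multiplicatively, hence the `Multiplicative`. -/
def pointsFunctor : CommAlgCat.{u} k ⥤ CommGrpCat.{u} where
  obj R := .of (Multiplicative (zeroSubgroup p F hF R))
  map {R S} φ := CommGrpCat.ofHom <| AddMonoidHom.toMultiplicative
    { toFun := fun x => ⟨fun i => φ.hom (x.1 i), by
        change aeval (fun i => φ.hom (x.1 i)) F = 0
        have h : φ.hom (aeval x.1 F) = aeval (fun i => φ.hom (x.1 i)) F :=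
          (comp_aeval_apply x.1 φ.hom F)
        rw [← h, show aeval x.1 F = 0 from x.2, map_zero]⟩
      map_zero' := by ext i; exact map_zero φ.hom
      map_add' := fun x y => by ext i; exact map_add φ.hom _ _ }

/-- The coordinate ring `k[X₁, …, Xₙ] / (F)` of `{F = 0}`. -/
abbrev coordRing : Type u := MvPolynomial (Fin n) k ⧸ Ideal.span {F}

/-- `k`-algebra homomorphisms `k[X₁, …, Xₙ] / (F) → R` are the points `x ∈ Rⁿ` with `F(x) = 0`. -/
def coordRingHomEquiv (R : Type u) [CommRing R] [Algebra k R] :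
    (coordRing F →ₐ[k] R) ≃ zeroSubgroup p F hF R where
  toFun φ := ⟨fun i => φ (Ideal.Quotient.mk _ (X i)), by
    change aeval (fun i => φ (Ideal.Quotient.mk _ (X i))) F = 0
    have h : (φ.comp (Ideal.Quotient.mkₐ k (Ideal.span {F}))) =
        aeval (fun i => φ (Ideal.Quotient.mk _ (X i))) := by
      ext i; simp
    rw [← h]
    have h0 : Ideal.Quotient.mkₐ k (Ideal.span {F}) F = 0 :=
      Ideal.Quotient.eq_zero_iff_mem.2 (Ideal.mem_span_singleton_self F)
    rw [AlgHom.comp_apply, h0, map_zero]⟩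
  invFun x := Ideal.Quotient.liftₐ _ (aeval x.1) fun a ha => by
    obtain ⟨b, rfl⟩ := Ideal.mem_span_singleton'.1 ha
    rw [map_mul, show aeval x.1 F = 0 from x.2, mul_zero]
  left_inv φ := by
    refine Ideal.Quotient.algHom_ext _ ?_
    ext i
    exact aeval_X _ i
  right_inv x := by
    ext i
    exact aeval_X _ i

/-- The coordinate ring represents the functor of points. -/
def coordRingRepresentableBy :
    ((unopUnop (CommAlgCat.{u} k) ⋙ pointsFunctor p F hF) ⋙ forget CommGrpCat).RepresentableBy
      (op (CommAlgCat.of k (coordRing F))) where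
  homEquiv {R} :=
    { toFun := fun φ => Multiplicative.ofAdd (coordRingHomEquiv p F hF R.unop φ.unop.hom)
      invFun := fun x =>
        (CommAlgCat.ofHom ((coordRingHomEquiv p F hF R.unop).symm (Multiplicative.toAdd x))).op
      left_inv := fun φ => Quiver.Hom.unop_inj <| CommAlgCat.hom_ext <|
        (coordRingHomEquiv p F hF R.unop).symm_apply_apply φ.unop.hom
      right_inv := fun x => (coordRingHomEquiv p F hF R.unop).apply_symm_apply (Multiplicative.toAdd x) }
  homEquiv_comp _ _ := rfl

/-- The coordinate ring, as a commutative group object of the opposite of the category of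
`k`-algebras; its group law is addition of points. -/
def affineVanishingGroup : CommGrp (CommAlgCat.{u} k)ᵒᵖ :=
  letI := CommGrpObj.ofRepresentableBy _ (unopUnop _ ⋙ pointsFunctor p F hF)
    (coordRingRepresentableBy p F hF)
  ⟨op (CommAlgCat.of k (coordRing F))⟩

/-- `Spec` as a functor from `k`-algebras to schemes over `Spec k`. -/
def specFunctor (k : Type u) [Field k] : (CommAlgCat.{u} k)ᵒᵖ ⥤ Over (Spec (.of k)) :=
  algSpec (.of k)

instance specFunctorBraided (k : Type u) [Field k] : (specFunctor k).Braided :=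
  braidedAlgSpec (R := .of k)

/-- The commutative `k`-group scheme `{F = 0} ⊆ 𝔾ₐⁿ`, for a `p`-polynomial `F`: the scheme
`Spec k[X₁, …, Xₙ] / (F)` over `Spec k`, with addition of points as its group law. -/
def vanishingGroup : CommGrp (Over (Spec (.of k))) :=
  (specFunctor k).mapCommGrp.obj (affineVanishingGroup p F hF)

end VanishingGroup

/-- The `k`-group scheme `𝒱_{P, L} = {P + L = 0} ⊆ 𝔾ₐⁿ`. -/
def groupV {k : Type u} [Field k] (p : ℕ) [Fact p.Prime] [CharP k p] {n : ℕ}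
    (P L : MvPolynomial (Fin n) k) (hP : IsPPolynomial p P) (hL : IsPPolynomial p L) :
    CommGrp (Over (Spec (.of k))) :=
  vanishingGroup p (P + L) (hP.add hL)

/-! ### The endomorphism ring of a commutative group object -/

section EndRing

open CategoryTheory.MonObj

universe v w

variable {C : Type w} [Category.{v} C] [CartesianMonoidalCategory C] [BraidedCategory C]

/-- The endomorphisms of a commutative group object, in the category of group objects; written
additively. -/
def EndRing (G : CommGrp C) : Type v := Additive (G.toGrp ⟶ G.toGrp)

/-- The endomorphism ring of a commutative group object: endomorphisms are added pointwise, through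
the group law of `G`, and multiplied by composition. -/
instance (G : CommGrp C) : Ring (EndRing G) where
  __ := (inferInstance : AddCommGroup (Additive (G.toGrp ⟶ G.toGrp)))
  mul f g := Additive.ofMul (g.toMul ≫ f.toMul)
  one := Additive.ofMul (𝟙 G.toGrp)
  mul_assoc f g h := congrArg Additive.ofMul (Category.assoc _ _ _).symm
  one_mul f := congrArg Additive.ofMul (Category.comp_id _)
  mul_one f := congrArg Additive.ofMul (Category.id_comp _)
  left_distrib f g h := congrArg Additive.ofMul
    (MonObj.mul_comp (C := Grp C) (Additive.toMul g) (Additive.toMul h) (Additive.toMul f))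
  right_distrib f g h := congrArg Additive.ofMul
    (MonObj.comp_mul (C := Grp C) (Additive.toMul h) (Additive.toMul f) (Additive.toMul g))
  zero_mul f := congrArg Additive.ofMul
    (MonObj.comp_one (C := Grp C) (Additive.toMul f))
  mul_zero f := congrArg Additive.ofMul
    (MonObj.one_comp (C := Grp C) (Additive.toMul f))

end EndRing

end

/-!
Let `F = P + L`, where `P = ∑ aᵢ Xᵢᵖ` and `L = ∑ lᵢ Xᵢ`. If `P` is universal then, as it has
`[k : kᵖ]` variables, the `aᵢ` form a basis of `k` over `kᵖ`, so `P` has no nontrivial zero.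

Modulo `F`, which has degree `p` in each variable, an endomorphism of `{F = 0}` is represented by
polynomials `fⱼ` of degree less than `p` in some fixed `Xᵢ`. This bound makes the lifts unique: as
the endomorphism is additive, so are the `fⱼ` as polynomials, and a comparison of the terms in `Xᵢ`
turns `F ∣ F(f)` into `F(f) = g F` with `g ∈ k`. As `P` is anisotropic, the leading forms of the
`aⱼ fⱼᵖ` cannot cancel in `P(f) = g F - L(f)`, hence the `fⱼ` are linear and the parts of degree
`p` and `1` give `P(f) = g P` and `L(f) = g L`. Iterating `p` times,
`P(f ∘ ⋯ ∘ f) = gᵖ P = P(g X)`, and `P` is injective, so the `p`-th iterate of `f` is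
multiplication by `g`. Applying `L` gives `gᵖ = g`, so that `P(f) = g P = P(g X)` and `f` is itself
multiplication by `g ∈ 𝔽ₚ`.
-/

/-! ### Division in one variable -/

section Division

variable {σ R : Type*} [CommRing R] {i j : σ} {F G h : MvPolynomial σ R}

/-- `F`, as a polynomial in `X i`, has positive degree and its leading coefficient is a unit of the
base ring; this is what division by `F` with respect to `X i` requires. -/
def HasUnitLeadingCoeff (i : σ) (F : MvPolynomial σ R) : Prop :=
  ∃ (u : Rˣ) (G : MvPolynomial σ R),
    degreeOf i G < degreeOf i F ∧ F = C (u : R) * X i ^ degreeOf i F + G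

theorem degreeOf_C_mul_X_pow_add [Nontrivial R] (u : Rˣ) {N : ℕ} (hG : degreeOf i G < N) :
    degreeOf i (C (u : R) * X i ^ N + G) = N := by
  have hlead : degreeOf i (C (u : R) * X i ^ N) = N := by
    rw [C_mul_X_pow_eq_monomial, degreeOf_monomial_eq _ _ u.ne_zero, Finsupp.single_eq_same]
  rw [degreeOf_add_eq_of_degreeOf_lt (hlead.symm ▸ hG), hlead]

theorem HasUnitLeadingCoeff.of_degreeOf_lt [Nontrivial R] (u : Rˣ) {N : ℕ}
    (hG : degreeOf i G < N) : HasUnitLeadingCoeff i (C (u : R) * X i ^ N + G) :=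
  ⟨u, G, by rwa [degreeOf_C_mul_X_pow_add u hG], by rw [degreeOf_C_mul_X_pow_add u hG]⟩

theorem HasUnitLeadingCoeff.rename {τ : Type*} {f : σ → τ} (hf : Function.Injective f)
    (hF : HasUnitLeadingCoeff i F) : HasUnitLeadingCoeff (f i) (rename f F) := by
  obtain ⟨u, G, hG, hFG⟩ := hF
  refine ⟨u, MvPolynomial.rename f G, ?_, ?_⟩
  · rwa [degreeOf_rename_of_injective hf, degreeOf_rename_of_injective hf]
  · rw [degreeOf_rename_of_injective hf]
    conv_lhs => rw [hFG]
    simp only [map_add, map_mul, map_pow, rename_C, rename_X]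

theorem HasUnitLeadingCoeff.exists_monomial_degreeOf_lt (hF : HasUnitLeadingCoeff i F)
    {m : σ →₀ ℕ} (hm : degreeOf i F ≤ m i) (c : R) :
    ∃ f', degreeOf i f' < m i ∧ F ∣ monomial m c - f' := by
  obtain ⟨u, G, hG, hFG⟩ := hF
  set N := degreeOf i F
  let q : MvPolynomial σ R := monomial (m - Finsupp.single i N) c * C (↑u⁻¹ : R)
  have hq : degreeOf i q ≤ m i - N := (degreeOf_mul_C_le _ _ _).trans <|
    (degreeOf_le_iff.2 fun d hd => by
      rw [Finset.mem_singleton.1 (support_monomial_subset hd)]; simp)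
  have hqu : q * (C (u : R) * X i ^ N) = monomial m c := by
    have hle : Finsupp.single i N ≤ m := Finsupp.single_le_iff.2 hm
    rw [mul_assoc, ← mul_assoc (C _), ← C_mul, Units.inv_mul, C_1, one_mul, X_pow_eq_monomial,
      monomial_mul, mul_one, tsub_add_cancel_of_le hle]
  refine ⟨-(q * G), ?_, q, ?_⟩
  · have := degreeOf_mul_le i q G
    rw [degreeOf_neg]
    omega
  · rw [hFG, ← hqu]
    ring

theorem HasUnitLeadingCoeff.exists_degreeOf_lt (hF : HasUnitLeadingCoeff i F)
    (f : MvPolynomial σ R) : ∃ f', degreeOf i f' < degreeOf i F ∧ F ∣ f - f' := by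
  induction hd : degreeOf i f using Nat.strong_induction_on generalizing f with
  | _ d ih =>
  have hmonomial : ∀ m ∈ f.support,
      ∃ r, degreeOf i r < degreeOf i F ∧ F ∣ monomial m (coeff m f) - r := by
    intro m hm
    rcases lt_or_ge (m i) (degreeOf i F) with hlt | hge
    · refine ⟨monomial m (coeff m f), ?_, by simp⟩
      rwa [degreeOf_monomial_eq m i (mem_support_iff.1 hm)]
    · obtain ⟨r, hr, hdvd⟩ := hF.exists_monomial_degreeOf_lt hge (coeff m f)
      obtain ⟨r', hr', hdvd'⟩ := ih _ (hd ▸ hr.trans_le (monomial_le_degreeOf i hm)) r rfl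
      exact ⟨r', hr', by simpa using dvd_add hdvd hdvd'⟩
  choose! r hr hdvd using hmonomial
  refine ⟨∑ m ∈ f.support, r m, ?_, ?_⟩
  · refine (degreeOf_sum_le i _ r).trans_lt ((Finset.sup_lt_iff ?_).2 hr)
    obtain ⟨_, _, hG, _⟩ := hF
    exact bot_le.trans_lt hG
  · simpa only [Finset.sum_sub_distrib, support_sum_monomial_coeff] using Finset.dvd_sum hdvd

theorem eq_zero_of_dvd_of_degreeOf_lt [NoZeroDivisors R] (hdvd : F ∣ h)
    (hlt : degreeOf i h < degreeOf i F) : h = 0 := by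
  obtain ⟨q, rfl⟩ := hdvd
  by_contra hne
  rw [degreeOf_mul_eq (left_ne_zero_of_mul hne) (right_ne_zero_of_mul hne)] at hlt
  omega

theorem eq_zero_of_mem_span_pair_of_degreeOf_lt [NoZeroDivisors R]
    (hF : HasUnitLeadingCoeff i F) (hG : degreeOf i G = 0) (hh : h ∈ Ideal.span {F, G})
    (hi : degreeOf i h < degreeOf i F) (hj : degreeOf j h < degreeOf j G) : h = 0 := by
  obtain ⟨a, b, rfl⟩ := Ideal.mem_span_pair.1 hh
  obtain ⟨b', hb', q, hq⟩ := hF.exists_degreeOf_lt b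
  have hdvd : F ∣ a * F + b * G - b' * G := ⟨a + q * G, by linear_combination G * hq⟩
  have hzero : a * F + b * G - b' * G = 0 := by
    refine eq_zero_of_dvd_of_degreeOf_lt hdvd ((degreeOf_sub_le _ _ _).trans_lt (max_lt hi ?_))
    exact (degreeOf_mul_le _ _ _).trans_lt (by omega)
  exact eq_zero_of_dvd_of_degreeOf_lt ⟨b', by linear_combination hzero⟩ hj

end Division

/-! ### Additive polynomials -/

theorem degreeOf_aeval_le {σ τ R : Type*} [CommRing R] {i : τ} {j : σ}
    {v : σ → MvPolynomial τ R} (hv : ∀ m, m ≠ j → degreeOf i (v m) = 0) (f : MvPolynomial σ R) :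
    degreeOf i (aeval v f) ≤ degreeOf j f * degreeOf i (v j) := by
  rw [aeval_def, eval₂_eq]
  refine (degreeOf_sum_le i _ _).trans (Finset.sup_le fun d hd => ?_)
  calc degreeOf i (C (coeff d f) * ∏ m ∈ d.support, v m ^ d m)
      ≤ ∑ m ∈ d.support, d m * degreeOf i (v m) :=
        (degreeOf_C_mul_le _ _ _).trans <| (degreeOf_prod_le i _ _).trans <|
          Finset.sum_le_sum fun m _ => degreeOf_pow_le i (v m) (d m)
    _ ≤ d j * degreeOf i (v j) := by
        classical
        rw [Finset.sum_eq_ite (a := j) fun m _ hm => by rw [hv m hm, mul_zero]]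
        split_ifs
        exacts [le_rfl, Nat.zero_le _]
    _ ≤ degreeOf j f * degreeOf i (v j) := by
        gcongr
        exact monomial_le_degreeOf j hd

section Additive

variable {σ τ R : Type*} [CommRing R] {i : σ} {f : MvPolynomial σ R}

variable (σ R) in
/-- The substitution `f(X) ↦ f(X + Y)`, where `X` and `Y` are two copies of the variables: the
comultiplication of the group `𝔾ₐ^σ`. -/
noncomputable def addComul : MvPolynomial σ R →ₐ[R] MvPolynomial (σ ⊕ σ) R :=
  aeval fun m => X (Sum.inl m) + X (Sum.inr m)

theorem addComul_X (m : σ) : addComul σ R (X m) = X (Sum.inl m) + X (Sum.inr m) :=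
  aeval_X _ m

theorem aeval_sumElim_addComul {A : Type*} [CommRing A] [Algebra R A] (y z : σ → A)
    (f : MvPolynomial σ R) : aeval (Sum.elim y z) (addComul σ R f) = aeval (y + z) f := by
  rw [addComul, comp_aeval_apply]
  simp only [map_add, aeval_X, Sum.elim_inl, Sum.elim_inr]
  rfl

variable (σ R) in
/-- The polynomials `f` with `f(X + Y) = f(X) + f(Y)`, which are those that define an additive map
`A^σ → A` for every algebra `A`. -/
noncomputable def additiveSubmodule : Submodule R (MvPolynomial σ R) :=
  LinearMap.eqLocus (addComul σ R).toLinearMap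
    ((rename Sum.inl : _ →ₐ[R] MvPolynomial (σ ⊕ σ) R).toLinearMap
      + (rename Sum.inr : _ →ₐ[R] MvPolynomial (σ ⊕ σ) R).toLinearMap)

theorem mem_additiveSubmodule :
    f ∈ additiveSubmodule σ R ↔ addComul σ R f = rename Sum.inl f + rename Sum.inr f :=
  Iff.rfl

theorem X_pow_mem_additiveSubmodule (p : ℕ) [Fact p.Prime] [CharP R p] (i : σ) (s : ℕ) :
    X i ^ p ^ s ∈ additiveSubmodule σ R := by
  rw [mem_additiveSubmodule, map_pow, addComul_X, add_pow_char_pow, map_pow, map_pow, rename_X,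
    rename_X]

theorem aeval_add_of_mem_additiveSubmodule (hf : f ∈ additiveSubmodule σ R) {A : Type*}
    [CommRing A] [Algebra R A] (y z : σ → A) : aeval (y + z) f = aeval y f + aeval z f := by
  rw [← aeval_sumElim_addComul, mem_additiveSubmodule.1 hf, map_add, aeval_rename, aeval_rename,
    Sum.elim_comp_inl, Sum.elim_comp_inr]

theorem constantCoeff_of_mem_additiveSubmodule (hf : f ∈ additiveSubmodule σ R) :
    constantCoeff f = 0 := by
  have h := aeval_add_of_mem_additiveSubmodule hf (0 : σ → R) 0
  simpa using h

theorem aeval_mem_additiveSubmodule (hf : f ∈ additiveSubmodule σ R) {v : σ → MvPolynomial τ R}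
    (hv : ∀ m, v m ∈ additiveSubmodule τ R) : aeval v f ∈ additiveSubmodule τ R := by
  rw [mem_additiveSubmodule, comp_aeval_apply, comp_aeval_apply, comp_aeval_apply]
  simp only [fun m => mem_additiveSubmodule.1 (hv m)]
  exact aeval_add_of_mem_additiveSubmodule hf _ _

theorem pderiv_inl_addComul (i : σ) (f : MvPolynomial σ R) :
    pderiv (Sum.inl i) (addComul σ R f) = addComul σ R (pderiv i f) := by
  classical
  induction f using MvPolynomial.induction_on with
  | C a => simp [addComul]
  | add f g hf hg => simp only [map_add, hf, hg]
  | mul_X f m ih =>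
    rcases eq_or_ne m i with rfl | hm
    · simp [ih, addComul_X]
    · simp [ih, addComul_X, hm]

theorem degreeOf_rename_of_notMem_range {g : σ → τ} {j : τ} (hj : j ∉ Set.range g)
    (f : MvPolynomial σ R) : degreeOf j (rename g f) = 0 := by
  classical
  by_contra h
  obtain ⟨m, -, hm⟩ :=
    Finset.mem_image.1 (vars_rename g f (mem_vars_iff_degreeOf_ne_zero.2 h))
  exact hj ⟨m, hm⟩

theorem pderiv_of_mem_additiveSubmodule (hf : f ∈ additiveSubmodule σ R) (i : σ) :
    pderiv i f = C (coeff (Finsupp.single i 1) f) := by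
  have hderiv : addComul σ R (pderiv i f) = rename Sum.inl (pderiv i f) := by
    have hinr : pderiv (Sum.inl i) (rename Sum.inr f : MvPolynomial (σ ⊕ σ) R) = 0 :=
      pderiv_eq_zero_of_notMem_vars fun h =>
        mem_vars_iff_degreeOf_ne_zero.1 h (degreeOf_rename_of_notMem_range (by simp) f)
    rw [← pderiv_inl_addComul, mem_additiveSubmodule.1 hf, map_add,
      pderiv_rename Sum.inl_injective, hinr, add_zero]
  calc pderiv i f
      = aeval (Sum.elim 0 X) (addComul σ R (pderiv i f)) := by
        rw [aeval_sumElim_addComul, zero_add, aeval_X_left_apply]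
    _ = aeval (0 : σ → MvPolynomial σ R) (pderiv i f) := by
        rw [hderiv, aeval_rename, Sum.elim_comp_inl]
    _ = C (coeff (Finsupp.single i 1) f) := by
        rw [aeval_zero, constantCoeff_eq, coeff_pderiv]
        simp

theorem degreeOf_sub_C_mul_X_of_mem_additiveSubmodule [NoZeroDivisors R] {p : ℕ} [CharP R p]
    (hf : f ∈ additiveSubmodule σ R) (hdeg : degreeOf i f < p) :
    degreeOf i (f - C (coeff (Finsupp.single i 1) f) * X i) = 0 := by
  classical
  have hcoeff (e : σ →₀ ℕ) (he : e ≠ 0) : coeff (e + Finsupp.single i 1) f = 0 := by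
    by_contra hne
    have hle : (e + Finsupp.single i 1 : σ →₀ ℕ) i ≤ degreeOf i f :=
      monomial_le_degreeOf i (mem_support_iff.2 hne)
    rw [Finsupp.add_apply, Finsupp.single_eq_same] at hle
    have hderiv : coeff (e + Finsupp.single i 1) f * ((e i + 1 : ℕ) : R) = 0 := by
      rw [Nat.cast_add_one, ← coeff_pderiv, pderiv_of_mem_additiveSubmodule hf, coeff_C,
        if_neg he.symm]
    have hcast : p ∣ e i + 1 :=
      (CharP.cast_eq_zero_iff R p _).1 ((mul_eq_zero.1 hderiv).resolve_left hne)
    exact (Nat.le_of_dvd (Nat.succ_pos _) hcast).not_gt (hle.trans_lt hdeg)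
  rw [← Nat.le_zero, degreeOf_le_iff]
  intro d hd
  by_contra! hlt
  obtain ⟨e, rfl⟩ : ∃ e, d = e + Finsupp.single i 1 :=
    ⟨d - Finsupp.single i 1, (tsub_add_cancel_of_le (Finsupp.single_le_iff.2 hlt)).symm⟩
  refine mem_support_iff.1 hd ?_
  rw [coeff_sub, coeff_C_mul, coeff_X]
  rcases eq_or_ne e 0 with rfl | he
  · simp
  · simp [hcoeff e he, he]

theorem aeval_single_of_mem_additiveSubmodule [NoZeroDivisors R] {p : ℕ} [CharP R p] [DecidableEq σ]
    (hf : f ∈ additiveSubmodule σ R) (hdeg : degreeOf i f < p) {A : Type*} [CommRing A]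
    [Algebra R A] (x : A) :
    aeval (Pi.single i x) f = coeff (Finsupp.single i 1) f • x := by
  have h : aeval (Pi.single i x) (f - C (coeff (Finsupp.single i 1) f) * X i) = 0 := by
    rw [aeval_eq_constantCoeff_of_vars]
    · simp [constantCoeff_of_mem_additiveSubmodule hf]
    · intro m hm
      refine Pi.single_eq_of_ne ?_ _
      rintro rfl
      exact mem_vars_iff_degreeOf_ne_zero.1 hm
        (degreeOf_sub_C_mul_X_of_mem_additiveSubmodule hf hdeg)
  rw [map_sub, sub_eq_zero] at h
  simp [h, Algebra.smul_def]

theorem degreeOf_le_of_mem_additiveSubmodule [DecidableEq σ] (hf : f ∈ additiveSubmodule σ R)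
    (i : σ) : degreeOf i f ≤ degreeOf i (aeval (Pi.single i (X i : MvPolynomial σ R)) f) := by
  have hsplit : (X : σ → MvPolynomial σ R) = Pi.single i (X i) + Function.update X i 0 := by
    ext1 m
    rcases eq_or_ne m i with rfl | hm <;> simp [*]
  have hrest : degreeOf i (aeval (Function.update X i 0 : σ → MvPolynomial σ R) f) = 0 := by
    refine Nat.le_zero.1 ((degreeOf_aeval_le (j := i) (fun m hm => ?_) f).trans_eq ?_)
    · rw [Function.update_of_ne hm, degreeOf_X_of_ne hm.symm]
    · simp
  calc degreeOf i f
      = degreeOf i (aeval (Pi.single i (X i) + Function.update X i 0) f) := by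
        rw [← hsplit, aeval_X_left_apply]
    _ ≤ degreeOf i (aeval (Pi.single i (X i)) f) := by
        rw [aeval_add_of_mem_additiveSubmodule hf]
        exact (degreeOf_add_le _ _ _).trans_eq (by rw [hrest, max_eq_left (Nat.zero_le _)])

theorem degreeOf_addComul_le (s : σ ⊕ σ) (f : MvPolynomial σ R) :
    degreeOf s (addComul σ R f) ≤ degreeOf (Sum.elim id id s) f := by
  rcases subsingleton_or_nontrivial R with hR | hR
  · rw [Subsingleton.elim (addComul σ R f) 0, degreeOf_zero]
    exact Nat.zero_le _
  refine (degreeOf_aeval_le (j := Sum.elim id id s) (fun m hm => ?_) f).trans ?_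
  · refine Nat.le_zero.1 ((degreeOf_add_le _ _ _).trans_eq ?_)
    rw [degreeOf_X_of_ne, degreeOf_X_of_ne, max_self] <;> rintro rfl <;> exact hm rfl
  · have hX (t : σ ⊕ σ) : degreeOf s (X t : MvPolynomial (σ ⊕ σ) R) ≤ 1 :=
      (degreeOf_le_totalDegree _ _).trans_eq (totalDegree_X t)
    exact (Nat.mul_le_mul_left _ ((degreeOf_add_le _ _ _).trans (max_le (hX _) (hX _)))).trans_eq
      (mul_one _)

theorem degreeOf_rename_inl_add_rename_inr_le (s : σ ⊕ σ) (f : MvPolynomial σ R) :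
    degreeOf s (rename Sum.inl f + rename Sum.inr f) ≤ degreeOf (Sum.elim id id s) f := by
  refine (degreeOf_add_le _ _ _).trans (max_le ?_ ?_) <;> rcases s with s | s
  · exact (degreeOf_rename_of_injective Sum.inl_injective s).le
  · exact (degreeOf_rename_of_notMem_range (by simp) f).trans_le (Nat.zero_le _)
  · exact (degreeOf_rename_of_notMem_range (by simp) f).trans_le (Nat.zero_le _)
  · exact (degreeOf_rename_of_injective Sum.inr_injective s).le

theorem mem_additiveSubmodule_of_mem_span [NoZeroDivisors R] {F : MvPolynomial σ R}
    (hF : HasUnitLeadingCoeff i F) (hdeg : degreeOf i f < degreeOf i F)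
    (hf : addComul σ R f - (rename Sum.inl f + rename Sum.inr f) ∈
      Ideal.span {rename Sum.inl F, (rename Sum.inr F : MvPolynomial (σ ⊕ σ) R)}) :
    f ∈ additiveSubmodule σ R := by
  have hlt (s : σ ⊕ σ) (hs : Sum.elim id id s = i) :
      degreeOf s (addComul σ R f - (rename Sum.inl f + rename Sum.inr f)) < degreeOf i F := by
    subst hs
    exact (degreeOf_sub_le _ _ _).trans_lt <| (max_le (degreeOf_addComul_le s f)
      (degreeOf_rename_inl_add_rename_inr_le s f)).trans_lt hdeg
  refine mem_additiveSubmodule.2 (sub_eq_zero.1 ?_)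
  refine eq_zero_of_mem_span_pair_of_degreeOf_lt (i := Sum.inl i) (j := Sum.inr i)
    (hF.rename Sum.inl_injective) (degreeOf_rename_of_notMem_range (by simp) F) hf ?_ ?_
  · exact (hlt (Sum.inl i) rfl).trans_eq (degreeOf_rename_of_injective Sum.inl_injective i).symm
  · exact (hlt (Sum.inr i) rfl).trans_eq (degreeOf_rename_of_injective Sum.inr_injective i).symm

end Additive

/-! ### Diagonal forms -/

section DiagonalForm

variable {σ R : Type*} [Fintype σ] [CommRing R]

/-- The diagonal form `∑ cᵢ Xᵢᴺ`. -/
noncomputable def diagonalForm (N : ℕ) (c : σ → R) : MvPolynomial σ R :=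
  ∑ i, C (c i) * X i ^ N

theorem aeval_diagonalForm {A : Type*} [CommRing A] [Algebra R A] (N : ℕ) (c : σ → R) (x : σ → A) :
    aeval x (diagonalForm N c) = ∑ i, c i • x i ^ N := by
  simp only [diagonalForm, map_sum, map_mul, algHom_C, map_pow, aeval_X, Algebra.smul_def]

theorem aeval_smul_diagonalForm {A : Type*} [CommRing A] [Algebra R A] (N : ℕ) (c : σ → R)
    (r : A) (x : σ → A) :
    aeval (r • x) (diagonalForm N c) = r ^ N * aeval x (diagonalForm N c) := by
  simp only [aeval_diagonalForm, Pi.smul_apply, smul_eq_mul, mul_pow, Finset.mul_sum,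
    mul_smul_comm]

theorem aeval_single_diagonalForm [DecidableEq σ] {A : Type*} [CommRing A] [Algebra R A] {N : ℕ}
    (hN : N ≠ 0) (c : σ → R) (i : σ) (x : A) :
    aeval (Pi.single i x) (diagonalForm N c) = c i • x ^ N := by
  rw [aeval_diagonalForm, Finset.sum_eq_single i, Pi.single_eq_same]
  · intro j _ hj
    rw [Pi.single_eq_of_ne hj, zero_pow hN, smul_zero]
  · exact fun hi => absurd (Finset.mem_univ i) hi

theorem isHomogeneous_diagonalForm (N : ℕ) (c : σ → R) : (diagonalForm N c).IsHomogeneous N :=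
  IsHomogeneous.sum _ _ _ fun i _ => isHomogeneous_C_mul_X_pow (c i) i N

theorem diagonalForm_mem_additiveSubmodule (p : ℕ) [Fact p.Prime] [CharP R p] (s : ℕ) (c : σ → R) :
    diagonalForm (p ^ s) c ∈ additiveSubmodule σ R :=
  Submodule.sum_mem _ fun i _ => by
    rw [← smul_eq_C_mul]
    exact Submodule.smul_mem _ _ (X_pow_mem_additiveSubmodule p i s)

theorem exists_diagonalForm_add_eq {N : ℕ} (hN : 1 < N) (a l : σ → R) (i : σ) :
    ∃ G, degreeOf i G < N ∧
      diagonalForm N a + diagonalForm 1 l = C (a i) * X i ^ N + G := by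
  classical
  refine ⟨∑ j ∈ Finset.univ.erase i, C (a j) * X j ^ N + diagonalForm 1 l, ?_, ?_⟩
  · refine (degreeOf_add_le _ _ _).trans_lt (max_lt ?_ ?_)
    · refine ((degreeOf_sum_le _ _ _).trans (Finset.sup_le fun j hj => ?_)).trans_lt
        (zero_lt_one.trans hN)
      exact (degreeOf_C_mul_le _ _ _).trans_eq
        (degreeOf_X_pow_of_ne N (Finset.ne_of_mem_erase hj).symm)
    · exact (degreeOf_le_totalDegree _ _).trans_lt
        ((isHomogeneous_diagonalForm 1 l).totalDegree_le.trans_lt hN)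
  · rw [← add_assoc, Finset.add_sum_erase _ (fun j => C (a j) * X j ^ N) (Finset.mem_univ i)]
    rfl

variable [Nontrivial R] {N : ℕ} {a : σ → R} {i : σ}

theorem degreeOf_diagonalForm_add (hN : 1 < N) (ha : IsUnit (a i)) (l : σ → R) :
    degreeOf i (diagonalForm N a + diagonalForm 1 l) = N := by
  obtain ⟨G, hG, hF⟩ := exists_diagonalForm_add_eq hN a l i
  obtain ⟨u, hu⟩ := ha
  rw [hF, ← hu, degreeOf_C_mul_X_pow_add u hG]

theorem hasUnitLeadingCoeff_diagonalForm_add (hN : 1 < N) (ha : IsUnit (a i)) (l : σ → R) :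
    HasUnitLeadingCoeff i (diagonalForm N a + diagonalForm 1 l) := by
  obtain ⟨G, hG, hF⟩ := exists_diagonalForm_add_eq hN a l i
  obtain ⟨u, hu⟩ := ha
  rw [hF, ← hu]
  exact .of_degreeOf_lt u hG

end DiagonalForm

section NormalForm

variable {k : Type u} [Field k] {p : ℕ} [Fact p.Prime] {n : ℕ}

theorem IsPPolynomial.exists_eq_diagonalForm {F : MvPolynomial (Fin n) k}
    (hF : IsPPolynomial p F) {d m : ℕ} (hd : d = p ^ m) (hhom : F.IsHomogeneous d) :
    ∃ c : Fin n → k, F = diagonalForm d c := by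
  subst hd
  obtain ⟨N, c, rfl⟩ := hF
  have hcomponent (i : Fin n) (j : ℕ) :
      homogeneousComponent (p ^ m) (C (c i j) * X i ^ p ^ j) =
        if m = j then C (c i m) * X i ^ p ^ m else 0 := by
    rw [homogeneousComponent_of_mem (isHomogeneous_C_mul_X_pow (c i j) i (p ^ j))]
    rcases eq_or_ne m j with rfl | hmj
    · rw [if_pos rfl, if_pos rfl]
    · rw [if_neg hmj, if_neg fun h =>
        hmj (Nat.pow_right_injective (Fact.out : p.Prime).two_le h)]
  refine ⟨fun i => if m < N then c i m else 0, ?_⟩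
  rw [← homogeneousComponent_eq_self hhom, map_sum]
  refine Finset.sum_congr rfl fun i _ => ?_
  simp only [map_sum, hcomponent, Finset.sum_ite_eq, Finset.mem_range]
  split_ifs <;> simp

end NormalForm

section Anisotropic

variable {σ τ k : Type*} [Field k] {p : ℕ}

/-- `F` has no zero other than the origin. -/
def IsAnisotropic (F : MvPolynomial σ k) : Prop :=
  ∀ x : σ → k, eval x F = 0 → x = 0

theorem coeff_smul_pow_char {R : Type*} [CommSemiring R] [Fact p.Prime] [CharP R p]
    (f : MvPolynomial τ R) (d : τ →₀ ℕ) : coeff (p • d) (f ^ p) = coeff d f ^ p := by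
  rw [← map_frobenius_expand p, coeff_map, coeff_expand_smul p (NeZero.ne p), frobenius_def]

variable [Fintype σ] {a : σ → k} {f : σ → MvPolynomial τ k}

theorem IsAnisotropic.ne_zero (hp : p ≠ 0) (ha : IsAnisotropic (diagonalForm p a)) (i : σ) :
    a i ≠ 0 := by
  classical
  intro hi
  have h := ha (Pi.single i 1) (by
    rw [← aeval_eq_eval, aeval_single_diagonalForm hp, hi, zero_smul])
  exact one_ne_zero (Pi.single_eq_zero_iff.1 h)

variable [Fact p.Prime] [CharP k p]

theorem coeff_smul_aeval_diagonalForm (a : σ → k) (f : σ → MvPolynomial τ k) (d : τ →₀ ℕ) :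
    coeff (p • d) (aeval f (diagonalForm p a)) =
      eval (fun j => coeff d (f j)) (diagonalForm p a) := by
  rw [← aeval_eq_eval]
  simp only [aeval_diagonalForm, coeff_sum, coeff_smul, coeff_smul_pow_char]

theorem IsAnisotropic.coeff_eq_zero (ha : IsAnisotropic (diagonalForm p a)) {d : τ →₀ ℕ}
    (hd : coeff (p • d) (aeval f (diagonalForm p a)) = 0) (j : σ) : coeff d (f j) = 0 :=
  congrFun (ha _ ((coeff_smul_aeval_diagonalForm a f d).symm.trans hd)) j

theorem IsAnisotropic.aeval_injective (ha : IsAnisotropic (diagonalForm p a)) :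
    Function.Injective fun f : σ → MvPolynomial τ k => aeval f (diagonalForm p a) := by
  intro f g hfg
  have hsub : aeval (f - g) (diagonalForm p a) = 0 := by
    have h := aeval_add_of_mem_additiveSubmodule
      (diagonalForm_mem_additiveSubmodule p 1 a) (f - g) g
    rw [sub_add_cancel, pow_one] at h
    exact left_eq_add.1 (hfg.symm.trans (h.trans (add_comm _ _)))
  refine sub_eq_zero.1 (funext fun j => MvPolynomial.ext _ _ fun d => ha.coeff_eq_zero ?_ j)
  rw [hsub, coeff_zero]

theorem IsAnisotropic.mul_totalDegree_le (ha : IsAnisotropic (diagonalForm p a)) (j : σ) :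
    p * (f j).totalDegree ≤ (aeval f (diagonalForm p a)).totalDegree := by
  rcases eq_or_ne (f j) 0 with hj | hj
  · rw [hj, totalDegree_zero, mul_zero]
    exact zero_le
  obtain ⟨d, hd, hdeg⟩ := Finset.exists_mem_eq_sup _ (support_nonempty.2 hj) Finsupp.degree
  have hsupp : p • d ∈ (aeval f (diagonalForm p a)).support :=
    mem_support_iff.2 fun h => mem_support_iff.1 hd (ha.coeff_eq_zero h j)
  calc p * (f j).totalDegree = p * d.degree := congrArg (p * ·) hdeg
    _ = (p • d).degree := (map_nsmul Finsupp.degree p d).symm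
    _ ≤ (aeval f (diagonalForm p a)).totalDegree := le_totalDegree hsupp

end Anisotropic

section Semiconj

theorem eq_smul_of_semiconj_mul {M V : Type*} [MonoidWithZero M] [IsRightCancelMulZero M] [SMul M V]
    {p : ℕ} {φ ℓ : V → M} {e : V → V} {g : M} (hφ : Function.Injective φ)
    (hφ_smul : ∀ c x, φ (c • x) = c ^ p * φ x) (hℓ_smul : ∀ c x, ℓ (c • x) = c * ℓ x)
    (hℓ : ∃ x, ℓ x ≠ 0) (hφe : Function.Semiconj φ e (g * ·))
    (hℓe : Function.Semiconj ℓ e (g * ·)) :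
    g ^ p = g ∧ ∀ x, e x = g • x := by
  have hiterate (x : V) : e^[p] x = g • x := hφ <| by
    rw [(hφe.iterate_right p).eq, mul_left_iterate, hφ_smul]
  have hg : g ^ p = g := by
    obtain ⟨x, hx⟩ := hℓ
    refine mul_right_cancel₀ hx ?_
    rw [← hℓ_smul g x, ← hiterate, (hℓe.iterate_right p).eq, mul_left_iterate]
  exact ⟨hg, fun x => hφ <| by rw [hφe.eq, hφ_smul, hg]⟩

end Semiconj

section Homogeneous

variable {σ R : Type*}

theorem isHomogeneous_one_of_totalDegree_le_one [CommSemiring R] {f : MvPolynomial σ R}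
    (hf : f.totalDegree ≤ 1) (h0 : constantCoeff f = 0) : f.IsHomogeneous 1 := by
  intro d hd
  have hle : d.degree ≤ 1 := (le_totalDegree (mem_support_iff.2 hd)).trans hf
  have hne : d.degree ≠ 0 := fun h => hd <| by
    rwa [(Finsupp.degree_eq_zero_iff d).1 h, ← constantCoeff_eq]
  exact (DFunLike.congr_fun Finsupp.degree_eq_weight_one d).symm.trans <|
    le_antisymm hle (Nat.one_le_iff_ne_zero.2 hne)

theorem aeval_eq_C_mul_of_aeval_add_eq_C_mul [CommRing R] {m n : ℕ} (hmn : m ≠ n)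
    {P L : MvPolynomial σ R} {f : σ → MvPolynomial σ R} {g : R}
    (hP : P.IsHomogeneous m) (hL : L.IsHomogeneous n) (hf : ∀ j, (f j).IsHomogeneous 1)
    (h : aeval f (P + L) = C g * (P + L)) : aeval f P = C g * P ∧ aeval f L = C g * L := by
  have hsub {M : MvPolynomial σ R} {d : ℕ} (hM : M.IsHomogeneous d) :
      (aeval f M - C g * M).IsHomogeneous d :=
    (one_mul d ▸ hM.aeval f hf).sub (hM.C_mul g)
  have hneg : aeval f P - C g * P = -(aeval f L - C g * L) := by
    rw [map_add] at h
    linear_combination h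
  have hzero : aeval f P - C g * P = 0 := by
    by_contra hne
    exact hmn ((hsub hP).inj_right (hneg ▸ (hsub hL).neg) hne)
  exact ⟨sub_eq_zero.1 hzero, sub_eq_zero.1 (neg_eq_zero.1 (hneg.symm.trans hzero))⟩

end Homogeneous

section Rigidity

variable {σ k : Type*} [Fintype σ] [Field k] {p : ℕ}

theorem aeval_smul_const_diagonalForm {R A : Type*} [CommRing R] [CommRing A] [Algebra R A] (N : ℕ)
    (c α : σ → R) (x : A) :
    aeval (fun j => α j • x) (diagonalForm N c) = eval α (diagonalForm N c) • x ^ N := by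
  rw [← aeval_eq_eval]
  simp only [aeval_diagonalForm, smul_pow, Finset.sum_smul, smul_smul, smul_eq_mul]

variable [CharP k p] {a l : σ → k} {f : σ → MvPolynomial σ k} {i : σ} {g : k}

theorem aeval_single_aeval_diagonalForm [DecidableEq σ]
    (hadd : ∀ j, f j ∈ additiveSubmodule σ k) (hdeg : ∀ j, degreeOf i (f j) < p) (N : ℕ)
    (c : σ → k) :
    aeval (Pi.single i (X i : MvPolynomial σ k)) (aeval f (diagonalForm N c)) =
      eval (fun j => coeff (Finsupp.single i 1) (f j)) (diagonalForm N c) • X i ^ N := by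
  rw [comp_aeval_apply, ← aeval_smul_const_diagonalForm]
  exact congrArg (fun v => aeval v (diagonalForm N c)) <| funext fun j =>
    aeval_single_of_mem_additiveSubmodule (hadd j) (hdeg j) (X i)

variable [Fact p.Prime]

theorem exists_aeval_diagonalForm_add_eq_C_mul (ha : a i ≠ 0)
    (hadd : ∀ j, f j ∈ additiveSubmodule σ k) (hdeg : ∀ j, degreeOf i (f j) < p)
    (hdvd : diagonalForm p a + diagonalForm 1 l ∣
      aeval f (diagonalForm p a + diagonalForm 1 l)) :
    ∃ g, aeval f (diagonalForm p a + diagonalForm 1 l) =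
      C g * (diagonalForm p a + diagonalForm 1 l) := by
  classical
  have hp : 1 < p := (Fact.out : p.Prime).one_lt
  set F := diagonalForm p a + diagonalForm 1 l with hF
  have hF_add : F ∈ additiveSubmodule σ k := by
    simpa only [pow_one, pow_zero] using Submodule.add_mem _
      (diagonalForm_mem_additiveSubmodule p 1 a) (diagonalForm_mem_additiveSubmodule p 0 l)
  let α : σ → k := fun j => coeff (Finsupp.single i 1) (f j)
  -- This `g` cancels the term in `Xᵢᵖ` of `F(f) - g F`, leaving degree at most `1` in `Xᵢ`.
  let g : k := eval α (diagonalForm p a) / a i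
  have hg : g * a i = eval α (diagonalForm p a) := div_mul_cancel₀ _ ha
  refine ⟨g, sub_eq_zero.1 ?_⟩
  have hsub_add : aeval f F - C g * F ∈ additiveSubmodule σ k := by
    rw [← smul_eq_C_mul]
    exact Submodule.sub_mem _ (aeval_mem_additiveSubmodule hF_add hadd)
      (Submodule.smul_mem _ g hF_add)
  have hline : aeval (Pi.single i (X i : MvPolynomial σ k)) (aeval f F - C g * F) =
      C (eval α (diagonalForm 1 l) - g * l i) * X i := by
    simp only [hF, map_add, map_sub, map_mul, algHom_C, algebraMap_eq,
      aeval_single_aeval_diagonalForm hadd hdeg,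
      aeval_single_diagonalForm (zero_lt_one.trans hp).ne', aeval_single_diagonalForm one_ne_zero,
      ← hg, smul_eq_C_mul, pow_one, α]
    ring
  refine eq_zero_of_dvd_of_degreeOf_lt (i := i) (dvd_sub hdvd (dvd_mul_left F _)) ?_
  calc degreeOf i (aeval f F - C g * F)
      ≤ degreeOf i (C (eval α (diagonalForm 1 l) - g * l i) * X i : MvPolynomial σ k) :=
        hline ▸ degreeOf_le_of_mem_additiveSubmodule hsub_add i
    _ ≤ 1 := (degreeOf_C_mul_le _ _ _).trans_eq (degreeOf_X_self i)
    _ < degreeOf i F := hp.trans_eq (degreeOf_diagonalForm_add hp ha.isUnit l).symm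

theorem IsAnisotropic.totalDegree_le_one (ha : IsAnisotropic (diagonalForm p a))
    (hf : aeval f (diagonalForm p a + diagonalForm 1 l) =
      C g * (diagonalForm p a + diagonalForm 1 l)) (j : σ) : (f j).totalDegree ≤ 1 := by
  have hp : 1 < p := (Fact.out : p.Prime).one_lt
  have : Nonempty σ := ⟨j⟩
  obtain ⟨m, hm⟩ := Finite.exists_max fun j => (f j).totalDegree
  have hL : (aeval f (diagonalForm 1 l)).totalDegree ≤ (f m).totalDegree := by
    rw [aeval_diagonalForm]
    refine totalDegree_finsetSum_le fun i _ => ?_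
    rw [pow_one]
    exact (totalDegree_smul_le _ _).trans (hm i)
  have hF : (C g * (diagonalForm p a + diagonalForm 1 l)).totalDegree ≤ p := by
    rw [← smul_eq_C_mul]
    refine (totalDegree_smul_le _ _).trans ((totalDegree_add _ _).trans (max_le ?_ ?_))
    exacts [(isHomogeneous_diagonalForm p a).totalDegree_le,
      (isHomogeneous_diagonalForm 1 l).totalDegree_le.trans hp.le]
  have hmax : p * (f m).totalDegree ≤ max p (f m).totalDegree := by
    rw [map_add] at hf
    refine (ha.mul_totalDegree_le m).trans ?_
    rw [eq_sub_of_add_eq hf]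
    exact (totalDegree_sub _ _).trans (max_le_max hF hL)
  refine (hm j).trans ?_
  by_contra! hlt
  rcases le_max_iff.1 hmax with h | h <;> nlinarith

theorem IsAnisotropic.exists_eq_C_mul_X (ha : IsAnisotropic (diagonalForm p a)) (hl : l ≠ 0)
    (hadd : ∀ j, f j ∈ additiveSubmodule σ k) (hdeg : ∀ j, degreeOf i (f j) < p)
    (hdvd : diagonalForm p a + diagonalForm 1 l ∣
      aeval f (diagonalForm p a + diagonalForm 1 l)) :
    ∃ g : k, g ^ p = g ∧ ∀ j, f j = C g * X j := by
  classical
  have hp : p.Prime := Fact.out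
  obtain ⟨g, hg⟩ := exists_aeval_diagonalForm_add_eq_C_mul (ha.ne_zero hp.ne_zero i) hadd hdeg hdvd
  have hhom (j : σ) : (f j).IsHomogeneous 1 := isHomogeneous_one_of_totalDegree_le_one
    (ha.totalDegree_le_one hg j) (constantCoeff_of_mem_additiveSubmodule (hadd j))
  obtain ⟨hgP, hgL⟩ := aeval_eq_C_mul_of_aeval_add_eq_C_mul hp.ne_one
    (isHomogeneous_diagonalForm p a) (isHomogeneous_diagonalForm 1 l) hhom hg
  have hsemiconj {M : MvPolynomial σ k} (hM : aeval f M = C g * M) :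
      Function.Semiconj (fun v : σ → MvPolynomial σ k => aeval v M) (fun v j => aeval v (f j))
        (C g * ·) := fun v => by
    dsimp only
    rw [← comp_aeval_apply, hM, map_mul, algHom_C, algebraMap_eq]
  obtain ⟨m, hm⟩ := Function.ne_iff.1 hl
  have hm' : aeval (Pi.single m 1 : σ → MvPolynomial σ k) (diagonalForm 1 l) ≠ 0 := by
    rwa [aeval_single_diagonalForm one_ne_zero, one_pow, smul_eq_C_mul, mul_one, Ne, C_eq_zero]
  obtain ⟨hgp, hgf⟩ := eq_smul_of_semiconj_mul ha.aeval_injective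
    (fun c v => aeval_smul_diagonalForm p a c v)
    (fun c v => (aeval_smul_diagonalForm 1 l c v).trans (by rw [pow_one])) ⟨_, hm'⟩
    (hsemiconj hgP) (hsemiconj hgL)
  refine ⟨g, C_injective σ k (by rw [C_pow, hgp]), fun j => ?_⟩
  rw [← aeval_X_left_apply (f j)]
  exact congrFun (hgf X) j

end Rigidity

section Universal

variable {k : Type u} [Field k] {p : ℕ} [Fact p.Prime] [CharP k p]

theorem HasDegreeOfImperfection.finrank_eq {r : ℕ} (hk : HasDegreeOfImperfection k p r) :
    Module.finrank (frobenius k p).fieldRange k = p ^ r := by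
  obtain ⟨b, hli, hspan⟩ := hk
  rw [Module.finrank_eq_card_basis (Module.Basis.mk hli hspan.ge), Fintype.card_fun,
    Fintype.card_fin, Fintype.card_fin]

theorem IsUniversal.isAnisotropic {n : ℕ} {P : MvPolynomial (Fin n) k}
    (hP_univ : IsUniversal P) (hn : Module.finrank (frobenius k p).fieldRange k = n)
    (hP : IsPPolynomial p P) (hP_hom : P.IsHomogeneous p) : IsAnisotropic P := by
  obtain ⟨a, rfl⟩ := hP.exists_eq_diagonalForm (pow_one p).symm hP_hom
  let ψ (x : k) : (frobenius k p).fieldRange := ⟨x ^ p, x, rfl⟩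
  have heval (x : Fin n → k) : eval x (diagonalForm p a) = ∑ i, ψ (x i) • a i := by
    rw [← aeval_eq_eval]
    exact (aeval_diagonalForm p a x).trans (Finset.sum_congr rfl fun i _ => mul_comm _ _)
  have hli : LinearIndependent (frobenius k p).fieldRange a := by
    refine linearIndependent_of_top_le_span_of_card_eq_finrank (fun y _ => ?_)
      ((Fintype.card_fin n).trans hn.symm)
    obtain ⟨x, rfl⟩ := hP_univ y
    dsimp only
    rw [heval]
    exact Submodule.sum_mem _ fun i _ =>
      Submodule.smul_mem _ _ (Submodule.subset_span (Set.mem_range_self i))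
  intro x hx
  funext i
  have hzero := Fintype.linearIndependent_iff.1 hli (fun i => ψ (x i)) ((heval x).symm.trans hx) i
  exact eq_zero_of_pow_eq_zero (congrArg Subtype.val hzero)

end Universal

/-! ### Endomorphisms of `{F = 0}` -/

section EndRing

universe v w v' w'

open CategoryTheory.MonObj

variable {C : Type w} [Category.{v} C] [CartesianMonoidalCategory C] [BraidedCategory C]
  {D : Type w'} [Category.{v'} D] [CartesianMonoidalCategory D] [BraidedCategory D]

/-- The isomorphism between the endomorphism rings of a commutative group object and of its image
under a fully faithful braided functor. -/
noncomputable def EndRing.mapEquiv (S : C ⥤ D) [S.Braided] (hS : S.FullyFaithful) (G : CommGrp C) :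
    EndRing G ≃+* EndRing (S.mapCommGrp.obj G) where
  toEquiv := (Additive.toMul.trans hS.mapGrp.homEquiv).trans Additive.ofMul
  map_mul' f g := congrArg Additive.ofMul (S.mapGrp.map_comp g.toMul f.toMul)
  map_add' f g := congrArg Additive.ofMul <| Grp.hom_ext _ _ <|
    Functor.map_mul S f.toMul.hom.hom g.toMul.hom.hom

end EndRing

section Points

open scoped CategoryTheory.MonObj

variable {k : Type u} [Field k] (p : ℕ) [Fact p.Prime] [CharP k p] {n : ℕ}
  (F : MvPolynomial (Fin n) k) (hF : IsPPolynomial p F)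

/-- Morphisms `Spec R ⟶ {F = 0}` (as morphisms in the opposite of the category of `k`-algebras) are
the zeros of `F` in `Rⁿ`, with the same group law. -/
noncomputable def pointEquiv (R : Type u) [CommRing R] [Algebra k R] :
    (op (CommAlgCat.of k R) ⟶ (affineVanishingGroup p F hF).X) ≃*
      Multiplicative (zeroSubgroup p F hF R) where
  toEquiv := (coordRingRepresentableBy p F hF).homEquiv
  map_mul' := ((yonedaMonObjIsoOfRepresentableBy _ ((unopUnop _ ⋙ pointsFunctor p F hF) ⋙
    forget₂ CommGrpCat GrpCat ⋙ forget₂ GrpCat MonCat) (coordRingRepresentableBy p F hF)).hom.app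
      (op (op (CommAlgCat.of k R)))).hom.map_mul

variable {p F hF}

/-- The action of an endomorphism of `{F = 0}` on the zeros of `F` in `Rⁿ`. -/
noncomputable def EndRing.pointMap (e : EndRing (affineVanishingGroup p F hF))
    (R : Type u) [CommRing R] [Algebra k R] : zeroSubgroup p F hF R →+ zeroSubgroup p F hF R :=
  AddMonoidHom.mk' (fun x => (pointEquiv p F hF R
    ((pointEquiv p F hF R).symm (.ofAdd x) ≫ e.toMul.hom.hom)).toAdd) fun x y => by
      rw [ofAdd_add, map_mul, MonObj.mul_comp, map_mul, toAdd_mul]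

variable (p F hF) in
/-- The image of the generic point of `{F = 0}`, the residue class of `X`, under an endomorphism. -/
noncomputable def genericImage :
    EndRing (affineVanishingGroup p F hF) →+ zeroSubgroup p F hF (coordRing F) :=
  AddMonoidHom.mk' (fun e => (pointEquiv p F hF _ e.toMul.hom.hom).toAdd) fun e f =>
    congrArg Multiplicative.toAdd (map_mul (pointEquiv p F hF _) e.toMul.hom.hom f.toMul.hom.hom)

theorem genericImage_injective : Function.Injective (genericImage p F hF) := fun _ _ h =>
  Additive.toMul.injective <| Grp.hom_ext _ _ <| (pointEquiv p F hF _).injective h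

theorem genericImage_one (i : Fin n) :
    (genericImage p F hF 1).1 i = Ideal.Quotient.mk _ (X i) := rfl

theorem genericImage_natCast (m : ℕ) (i : Fin n) :
    (genericImage p F hF m).1 i = Ideal.Quotient.mk _ (C (m : k) * X i) := by
  rw [← nsmul_one m, map_nsmul, AddSubgroup.coe_nsmul, Pi.smul_apply, genericImage_one, ← map_nsmul,
    nsmul_eq_mul, map_natCast]

theorem EndRing.pointMap_apply {e : EndRing (affineVanishingGroup p F hF)}
    {f : Fin n → MvPolynomial (Fin n) k}
    (hf : ∀ i, (genericImage p F hF e).1 i = Ideal.Quotient.mk _ (f i))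
    {R : Type u} [CommRing R] [Algebra k R] (x : zeroSubgroup p F hF R) (i : Fin n) :
    (e.pointMap R x).1 i = aeval x.1 (f i) := by
  change (coordRingHomEquiv p F hF R).symm x ((genericImage p F hF e).1 i) = _
  rw [hf]
  rfl

end Points

section Lift

variable {k : Type u} [Field k] {p : ℕ} [Fact p.Prime] [CharP k p] {n : ℕ}
  {F : MvPolynomial (Fin n) k} {hF : IsPPolynomial p F}
  {e : EndRing (affineVanishingGroup p F hF)} {f : Fin n → MvPolynomial (Fin n) k}

theorem exists_genericImage_eq_mk_degreeOf_lt {i : Fin n} (hlead : HasUnitLeadingCoeff i F)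
    (e : EndRing (affineVanishingGroup p F hF)) (j : Fin n) :
    ∃ f, degreeOf i f < degreeOf i F ∧ (genericImage p F hF e).1 j = Ideal.Quotient.mk _ f := by
  obtain ⟨f₀, hf₀⟩ := Ideal.Quotient.mk_surjective ((genericImage p F hF e).1 j)
  obtain ⟨f, hdeg, hdvd⟩ := hlead.exists_degreeOf_lt f₀
  exact ⟨f, hdeg, hf₀.symm.trans (Ideal.Quotient.eq.2 (Ideal.mem_span_singleton.2 hdvd))⟩

theorem dvd_aeval_of_genericImage_eq_mk
    (hf : ∀ j, (genericImage p F hF e).1 j = Ideal.Quotient.mk _ (f j)) : F ∣ aeval f F := by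
  have hzero : aeval (genericImage p F hF e).1 F = 0 := (genericImage p F hF e).2
  rw [funext hf] at hzero
  rw [← Ideal.mem_span_singleton, ← Ideal.Quotient.eq_zero_iff_mem, ← hzero]
  exact comp_aeval_apply f (Ideal.Quotient.mkₐ k (Ideal.span {F})) F

theorem addComul_sub_mem_span_of_genericImage_eq_mk
    (hf : ∀ j, (genericImage p F hF e).1 j = Ideal.Quotient.mk _ (f j)) (j : Fin n) :
    addComul (Fin n) k (f j) - (rename Sum.inl (f j) + rename Sum.inr (f j)) ∈
      Ideal.span {rename Sum.inl F, (rename Sum.inr F : MvPolynomial (Fin n ⊕ Fin n) k)} := by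
  set I := Ideal.span {rename Sum.inl F, (rename Sum.inr F : MvPolynomial (Fin n ⊕ Fin n) k)}
  let π := Ideal.Quotient.mkₐ k I
  have haeval (s : Fin n → Fin n ⊕ Fin n) (G : MvPolynomial (Fin n) k) :
      aeval (fun m => π (X (s m))) G = π (rename s G) := by
    rw [← aeval_X_left_apply (rename s G), aeval_rename, comp_aeval_apply]
    rfl
  let y : zeroSubgroup p F hF (MvPolynomial (Fin n ⊕ Fin n) k ⧸ I) :=
    ⟨fun m => π (X (Sum.inl m)), (haeval _ F).trans
      (Ideal.Quotient.eq_zero_iff_mem.2 (Ideal.subset_span (Set.mem_insert _ _)))⟩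
  let z : zeroSubgroup p F hF (MvPolynomial (Fin n ⊕ Fin n) k ⧸ I) :=
    ⟨fun m => π (X (Sum.inr m)), (haeval _ F).trans
      (Ideal.Quotient.eq_zero_iff_mem.2 (Ideal.subset_span (Set.mem_insert_of_mem _ rfl)))⟩
  have hadd := congrArg (fun w => w.1 j) (map_add (e.pointMap _) y z)
  simp only [AddSubgroup.coe_add, Pi.add_apply, EndRing.pointMap_apply hf] at hadd
  have hcomul : π (addComul (Fin n) k (f j)) = aeval (y.1 + z.1) (f j) := by
    rw [addComul, comp_aeval_apply]
    simp only [map_add]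
    rfl
  refine Ideal.Quotient.eq.1 (hcomul.trans (hadd.trans ?_))
  rw [haeval, haeval]
  exact (map_add π _ _).symm

end Lift

section PrimeField

variable {p : ℕ} [Fact p.Prime]

theorem exists_natCast_eq_of_pow_eq_self {k : Type*} [Field k] [CharP k p] {g : k}
    (hg : g ^ p = g) : ∃ m : ℕ, (m : k) = g := by
  have hmem := (Subfield.mem_bot_iff_pow_eq_self k p).2 hg
  rw [← ZMod.fieldRange_castHom_eq_bot p] at hmem
  obtain ⟨x, rfl⟩ := hmem
  exact ⟨x.val, by rw [ZMod.castHom_apply, ZMod.natCast_val]⟩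

theorem nonempty_ringEquiv_zmod_of_natCast_surjective {E : Type*} [Ring E] [Nontrivial E]
    (hp : (p : E) = 0) (hE : Function.Surjective (Nat.cast : ℕ → E)) :
    Nonempty (E ≃+* ZMod p) := by
  have : CharP E p := (CharP.charP_iff_prime_eq_zero Fact.out).2 hp
  refine ⟨(RingEquiv.ofBijective (ZMod.castHom dvd_rfl E) ⟨RingHom.injective _, fun e => ?_⟩).symm⟩
  obtain ⟨m, rfl⟩ := hE e
  exact ⟨m, map_natCast _ m⟩

end PrimeField

section EndRing

variable {k : Type u} [Field k] {p : ℕ} [Fact p.Prime] [CharP k p] {n : ℕ}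

theorem natCast_endRing_eq_zero {F : MvPolynomial (Fin n) k} (hF : IsPPolynomial p F) :
    (p : EndRing (affineVanishingGroup p F hF)) = 0 := by
  refine genericImage_injective (Subtype.ext (funext fun i => ?_))
  rw [genericImage_natCast, CharP.cast_eq_zero, C_0, zero_mul, map_zero, map_zero]
  rfl

theorem nontrivial_endRing {F : MvPolynomial (Fin n) k} (hF : IsPPolynomial p F) {i : Fin n}
    (hi : 1 < degreeOf i F) : Nontrivial (EndRing (affineVanishingGroup p F hF)) := by
  refine ⟨1, 0, fun h => X_ne_zero (R := k) i (eq_zero_of_dvd_of_degreeOf_lt (i := i) ?_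
    ((degreeOf_X_self i).trans_lt hi))⟩
  refine Ideal.mem_span_singleton.1 (Ideal.Quotient.eq_zero_iff_mem.1 ?_)
  rw [← genericImage_one (hF := hF), h, map_zero]
  rfl

variable {a l : Fin n → k}

theorem IsAnisotropic.natCast_endRing_surjective (ha : IsAnisotropic (diagonalForm p a))
    (hl : l ≠ 0) (hF : IsPPolynomial p (diagonalForm p a + diagonalForm 1 l)) :
    Function.Surjective (Nat.cast :
      ℕ → EndRing (affineVanishingGroup p (diagonalForm p a + diagonalForm 1 l) hF)) := by
  intro e
  have hp : p.Prime := Fact.out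
  obtain ⟨i, -⟩ := Function.ne_iff.1 hl
  have hai := (ha.ne_zero hp.ne_zero i).isUnit
  have hlead := hasUnitLeadingCoeff_diagonalForm_add hp.one_lt hai l
  have hdegF := degreeOf_diagonalForm_add hp.one_lt hai l
  choose f hdeg hf using exists_genericImage_eq_mk_degreeOf_lt hlead e
  obtain ⟨g, hg, hfg⟩ := ha.exists_eq_C_mul_X hl
    (fun j => mem_additiveSubmodule_of_mem_span hlead (hdeg j)
      (addComul_sub_mem_span_of_genericImage_eq_mk hf j))
    (fun j => (hdeg j).trans_eq hdegF) (dvd_aeval_of_genericImage_eq_mk hf)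
  obtain ⟨m, rfl⟩ := exists_natCast_eq_of_pow_eq_self hg
  refine ⟨m, genericImage_injective (Subtype.ext (funext fun j => ?_))⟩
  rw [genericImage_natCast, hf, hfg]

theorem IsAnisotropic.nonempty_endRing_affineVanishingGroup_ringEquiv
    (ha : IsAnisotropic (diagonalForm p a)) (hl : l ≠ 0)
    (hF : IsPPolynomial p (diagonalForm p a + diagonalForm 1 l)) :
    Nonempty (EndRing (affineVanishingGroup p (diagonalForm p a + diagonalForm 1 l) hF) ≃+*
      ZMod p) := by
  have hp : p.Prime := Fact.out
  obtain ⟨i, -⟩ := Function.ne_iff.1 hl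
  have := nontrivial_endRing hF (hp.one_lt.trans_eq
    (degreeOf_diagonalForm_add hp.one_lt (ha.ne_zero hp.ne_zero i).isUnit l).symm)
  exact nonempty_ringEquiv_zmod_of_natCast_surjective (natCast_endRing_eq_zero hF)
    (ha.natCast_endRing_surjective hl hF)

end EndRing

theorem mainTheorem9_general {k : Type u} [Field k] (p : ℕ) [Fact p.Prime] [CharP k p] {n : ℕ}
    (P L : MvPolynomial (Fin n) k)
    (hP : IsPPolynomial p P) (hP_hom : P.IsHomogeneous p) (hP_anis : IsAnisotropic P)
    (hL : IsPPolynomial p L) (hL_hom : L.IsHomogeneous 1) (hL_ne : L ≠ 0) :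
    Nonempty (EndRing (groupV p P L hP hL) ≃+* ZMod p) := by
  obtain ⟨a, rfl⟩ := hP.exists_eq_diagonalForm (pow_one p).symm hP_hom
  obtain ⟨l, rfl⟩ := hL.exists_eq_diagonalForm (pow_zero p).symm hL_hom
  have hl : l ≠ 0 := by
    rintro rfl
    exact hL_ne (Finset.sum_eq_zero fun i _ => by rw [Pi.zero_apply, C_0, zero_mul])
  obtain ⟨φ⟩ := hP_anis.nonempty_endRing_affineVanishingGroup_ringEquiv hl (hP.add hL)
  let ψ := EndRing.mapEquiv (specFunctor k) (algSpec.fullyFaithful (R := .of k))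
    (affineVanishingGroup p _ (hP.add hL))
  exact ⟨ψ.symm.trans φ⟩

theorem mainTheorem9 {k : Type u} [Field k] (p : ℕ) [Fact p.Prime] [CharP k p]
    (r : ℕ) (hr : 0 < r) (hk : HasDegreeOfImperfection k p r)
    (P L : MvPolynomial (Fin (p ^ r)) k)
    (hP : IsPPolynomial p P) (hP_hom : P.IsHomogeneous p) (hP_univ : IsUniversal P)
    (hL : IsPPolynomial p L) (hL_hom : L.IsHomogeneous 1) (hL_ne : L ≠ 0) :
    Nonempty (EndRing (groupV p P L hP hL) ≃+* ZMod p) :=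
  mainTheorem9_general p P L hP hP_hom (hP_univ.isAnisotropic hk.finrank_eq hP hP_hom) hL hL_hom
    hL_ne
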